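/- Let $0<\beta<1$ and $\lambda>0$. On a probability space, let $D=(D(t))_{t\ge 0}$ be a standard $\beta$-stable subordinator, that is, a process with $D(0)=0$, stationary independent increments, nondecreasing right-continuous paths and $\mathbb{E}[e^{-sD(t)}]=e^{-ts^\beta}$ for all $s>0$, $t\ge 0$. Let $E(t)=\inf\{r>0 : D(r)>t\}$ be its right-continuous inverse. Let $N_1=(N_1(t))_{t\ge 0}$ be a Poisson process of rate $\lambda$, independent of $D$; that is, almost surely $N_1(t)=\max\{n\ge 0 : W_1+\cdots+W_n\le t\}$ for all $t\ge 0$, where the $W_n$ are IID with $\mathbb{P}(W_n>t)=e^{-\lambda t}$ for $t\ge 0$. Let $E_\beta(z)=\sum_{k=0}^\infty z^k/\Gamma(1+\beta k)$ be the Mittag-Leffler function. Then the process $N_1(E(t))$ is a fractional Poisson process: there are IID random variables $J_1,J_2,\dots$ with $\mathbb{P}(J_n>t)=E_\beta(-\lambda t^\beta)$ for all $t\ge 0$ such that, almost surely, $N_1(E(t))=\max\{n\ge 0 : J_1+\cdots+J_n\le t\}$ for all $t\ge 0$. Moreover, the jump times $\tau_n=\sup\{t>0 : N_1(E(t))<n\}$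 (with $\tau_0=0$) are almost surely finite for all $n$, and the waiting times between jumps $X_n=\tau_n-\tau_{n-1}$, $n\ge 1$, are IID with $\mathbb{P}(X_n>t)=E_\beta(-\lambda t^\beta)$ for all $t\ge 0$. -/

import Mathlib

open MeasureTheory ProbabilityTheory Filter Topology
open scoped NNReal ENNReal

namespace FracPoisson

/-- The Mittag-Leffler function `E_β(z) = ∑_{k ≥ 0} z^k / Γ(1 + β k)`, for real `z`
(the series converges absolutely for every `z` when `β > 0`). -/
noncomputable def mittagLeffler (β z : ℝ) : ℝ :=
  ∑' k : ℕ, z ^ k / Real.Gamma (1 + β * k)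

variable {Ω : Type*} [MeasurableSpace Ω]

/-- `J 0, J 1, …` are IID (nonnegative) waiting times with survival function `S`:
they are independent random variables with `P(J n > t) = S t` for all `t ≥ 0`. -/
structure IsIIDWaitingTimes (J : ℕ → Ω → ℝ) (S : ℝ≥0 → ℝ) (P : Measure Ω) : Prop where
  aemeasurable : ∀ n, AEMeasurable (J n) P
  indep : iIndepFun J P
  survival : ∀ n (t : ℝ≥0), P.real {ω | (t : ℝ) < J n ω} = S t

/-- `M` is the renewal process with IID waiting times `J 0, J 1, …` of survival function `S`:
almost surely, `M t = max {n ≥ 0 : J 0 + ⋯ + J (n - 1) ≤ t}` for all `t ≥ 0`. -/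
structure IsRenewalProcessWith (M : ℝ≥0 → Ω → ℕ) (J : ℕ → Ω → ℝ) (S : ℝ≥0 → ℝ)
    (P : Measure Ω) : Prop where
  waiting : IsIIDWaitingTimes J S P
  count : ∀ᵐ ω ∂P, ∀ t : ℝ≥0,
    IsGreatest {n : ℕ | ∑ i ∈ Finset.range n, J i ω ≤ (t : ℝ)} (M t ω)

/-- A Poisson process of rate `lam`: the renewal process with IID exponential waiting times,
`P(W > t) = exp (-lam t)`. -/
def IsPoissonProcess (lam : ℝ) (N : ℝ≥0 → Ω → ℕ) (P : Measure Ω) : Prop :=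
  ∃ W : ℕ → Ω → ℝ, IsRenewalProcessWith N W (fun t => Real.exp (-lam * t)) P

/-- The survival function `t ↦ E_β(-lam t^β)` of the Mittag-Leffler distribution. -/
noncomputable def mittagLefflerSurvival (β lam : ℝ) (t : ℝ≥0) : ℝ :=
  mittagLeffler β (-lam * (t : ℝ) ^ β)

/-- A fractional Poisson process: a renewal process with IID Mittag-Leffler waiting times. -/
def IsFractionalPoissonProcess (β lam : ℝ) (M : ℝ≥0 → Ω → ℕ) (P : Measure Ω) : Prop :=
  ∃ J : ℕ → Ω → ℝ, IsRenewalProcessWith M J (mittagLefflerSurvival β lam) P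

/-- A standard `β`-stable subordinator: a process with stationary independent increments started
at `0`, with nondecreasing right-continuous paths (left limits then exist automatically), and
with `E[exp (-s D(t))] = exp (-t s^β)`. -/
structure IsStableSubordinator (β : ℝ) (D : ℝ≥0 → Ω → ℝ) (P : Measure Ω) : Prop where
  measurable : ∀ t, Measurable (D t)
  zero : ∀ᵐ ω ∂P, D 0 ω = 0
  indep : HasIndepIncrements D P
  stationary : ∀ s t, IdentDistrib (fun ω => D (s + t) ω - D s ω) (D t) P P
  mono : ∀ᵐ ω ∂P, Monotone fun t => D t ω
  rightCont : ∀ᵐ ω ∂P, ∀ t, ContinuousWithinAt (fun r => D r ω) (Set.Ici t) t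
  laplace : ∀ (t : ℝ≥0) (s : ℝ), 0 < s →
    ∫ ω, Real.exp (-s * D t ω) ∂P = Real.exp (-(t : ℝ) * s ^ β)

/-- The right-continuous inverse (first passage time) `E(t) = inf {r > 0 : D(r) > t}`. -/
noncomputable def inverse (D : ℝ≥0 → Ω → ℝ) (t : ℝ≥0) (ω : Ω) : ℝ≥0 :=
  sInf {r : ℝ≥0 | 0 < r ∧ (t : ℝ) < D r ω}

/-- The time-changed process `N(E(t))`. -/
def timeChange (N : ℝ≥0 → Ω → ℕ) (E : ℝ≥0 → Ω → ℝ≥0) (t : ℝ≥0) (ω : Ω) : ℕ :=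
  N (E t ω) ω

/-- The set `{t > 0 : M(t) < n}` of the times before the `n`-th jump of a counting process. -/
def timesBefore (M : ℝ≥0 → Ω → ℕ) (n : ℕ) (ω : Ω) : Set ℝ≥0 :=
  {t : ℝ≥0 | 0 < t ∧ M t ω < n}

/-- The `n`-th jump time `τ_n = sup {t > 0 : M(t) < n}`, with `τ_0 = sup ∅ = 0`. -/
noncomputable def jumpTime (M : ℝ≥0 → Ω → ℕ) (n : ℕ) (ω : Ω) : ℝ≥0 :=
  sSup (timesBefore M n ω)

/-- The waiting times between jumps: entry `n` is `τ_{n+1} - τ_n`. -/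
noncomputable def waitingTime (M : ℝ≥0 → Ω → ℕ) (n : ℕ) (ω : Ω) : ℝ :=
  (jumpTime M (n + 1) ω : ℝ) - jumpTime M n ω

end FracPoisson

/-!
Let `W 0, W 1, …` be the waiting times of `N` and `T_n = W 0 + ⋯ + W (n - 1)` its epochs. Pathwise,
`n ≤ N (E t)` iff `T_n ≤ E t` iff `D (T_n -) ≤ t` (`le_timeChange_iff`), so the jump times of
`N ∘ E` are the left limits `D (T_n -)`, and its waiting times are
`J n = D (T_{n+1} -) - D (T_n -)`.

The waiting times `W` are measurable functions of the path of `N`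
(`exists_measurable_waitingTimes`), hence independent of `D`. Evaluating left limits along a
countable dense set (`leftValue`) makes `J` a jointly measurable function of `W` and of countably
many values of `D`, so Fubini's theorem applies and `W` can be frozen. At fixed times `D` is almost surely continuous (`ae_leftValue_eq`), so, given
`W`, the `J n` are independent increments of `D`, distributed as `D (W n)`
(`lintegral_changedWaitingTime`). Integrating out the independent `W n` shows that the `J n` are
independent (`iIndepFun_changedWaitingTime`), with
`E[exp (-s J n)] = E[exp (-s^β W n)] = lam / (lam + s^β)`.

It remains to recognize this Laplace transform. The tail of `J n` has Laplace transform
`(1 - lam / (lam + s^β)) / s`, and integrating the Mittag-Leffler series term by term gives the same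
value for `t ↦ E_β(-lam t^β)` as soon as `s^β > lam` (`integral_exp_mul_mittagLeffler`). Laplace
transforms determine right-continuous functions (`eq_of_laplace_eq`), by the Weierstrass
approximation theorem in the variable `exp (-t)`.
-/

/-! ### Uniqueness for Laplace transforms -/

/-- A function integrable on `(0, ∞)` whose Laplace transform vanishes at all natural numbers
vanishes almost everywhere: a test function supported in `(0, ∞)` is a continuous function of
`exp (-t)`, hence a uniform limit of polynomials in `exp (-t)`. -/
lemma ae_eq_zero_of_laplace_nat_eq_zero {u : ℝ → ℝ} (hu : IntegrableOn u (Set.Ioi 0))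
    (h : ∀ n : ℕ, ∫ t in Set.Ioi (0 : ℝ), Real.exp (-t) ^ n * u t = 0) :
    ∀ᵐ t, t ∈ Set.Ioi (0 : ℝ) → u t = 0 := by
  have hint (k : ℝ → ℝ) (hk : Continuous k) : IntegrableOn
      (fun t => k (Real.exp (-t)) * u t) (Set.Ioi 0) := by
    obtain ⟨C, hC⟩ := isCompact_Icc.exists_bound_of_continuousOn
      (hk.continuousOn (s := Set.Icc 0 1))
    refine Integrable.bdd_mul (c := C) hu (by fun_prop) ?_
    filter_upwards [ae_restrict_mem measurableSet_Ioi] with t ht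
    exact hC _ ⟨(Real.exp_pos _).le, Real.exp_le_one_iff.2 (neg_nonpos.2 (le_of_lt ht))⟩
  have hpoly (p : Polynomial ℝ) :
      ∫ t in Set.Ioi (0 : ℝ), p.eval (Real.exp (-t)) * u t = 0 := by
    induction p using Polynomial.induction_on' with
    | add p q hp hq =>
      simp only [Polynomial.eval_add, add_mul]
      rw [integral_add (hint _ p.continuous) (hint _ q.continuous), hp, hq, add_zero]
    | monomial n a =>
      simp only [Polynomial.eval_monomial, mul_assoc]
      rw [integral_const_mul, h, mul_zero]
  refine isOpen_Ioi.ae_eq_zero_of_integral_contDiff_smul_eq_zero hu.locallyIntegrableOn ?_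
  intro φ hφ hφc hφs
  have hφ0 : φ 0 = 0 := image_eq_zero_of_notMem_tsupport fun h0 => lt_irrefl (0 : ℝ) (hφs h0)
  have hψ : Continuous fun y => φ (-Real.log y) := by
    rw [continuous_iff_continuousAt]
    intro y
    rcases eq_or_ne y 0 with rfl | hy
    · rw [continuousAt_iff_punctured_nhds]
      simp only [Real.log_zero, neg_zero, hφ0]
      have h0 : Tendsto φ atTop (𝓝 0) :=
        hφc.is_zero_at_infty.mono_left atTop_le_cocompact
      exact h0.comp (tendsto_neg_atBot_atTop.comp Real.tendsto_log_nhdsNE_zero)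
    · exact (hφ.continuous.continuousAt).comp (Real.continuousAt_log hy).neg
  have hφu : ∫ t, φ t • u t = ∫ t in Set.Ioi (0 : ℝ), φ (-Real.log (Real.exp (-t))) * u t := by
    simp only [Real.log_exp, neg_neg, smul_eq_mul]
    refine (setIntegral_eq_integral_of_forall_compl_eq_zero fun t ht => ?_).symm
    rw [image_eq_zero_of_notMem_tsupport fun h0 => ht (hφs h0), zero_mul]
  rw [hφu]
  set A := ∫ t in Set.Ioi (0 : ℝ), |u t|
  have hA : 0 ≤ A := integral_nonneg fun t => abs_nonneg _
  have key : ∀ ε > 0, |∫ t in Set.Ioi (0 : ℝ), φ (-Real.log (Real.exp (-t))) * u t| ≤ ε * A := by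
    intro ε hε
    obtain ⟨p, hp⟩ := exists_polynomial_near_of_continuousOn 0 1 _ hψ.continuousOn ε hε
    have e : ∫ t in Set.Ioi (0 : ℝ), φ (-Real.log (Real.exp (-t))) * u t
        = ∫ t in Set.Ioi (0 : ℝ), (φ (-Real.log (Real.exp (-t))) * u t
          - p.eval (Real.exp (-t)) * u t) := by
      rw [integral_sub (hint _ hψ) (hint _ p.continuous), hpoly, sub_zero]
    rw [e, ← integral_const_mul, ← Real.norm_eq_abs]
    refine norm_integral_le_of_norm_le (hu.abs.const_mul ε) ?_
    filter_upwards [ae_restrict_mem measurableSet_Ioi] with t ht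
    rw [← sub_mul, norm_mul, Real.norm_eq_abs, Real.norm_eq_abs, abs_sub_comm]
    gcongr
    exact (hp _ ⟨(Real.exp_pos _).le, Real.exp_le_one_iff.2 (neg_nonpos.2 (le_of_lt ht))⟩).le
  by_contra hne
  have hpos := abs_pos.2 hne
  have h1 := key (|∫ t in Set.Ioi (0 : ℝ), φ (-Real.log (Real.exp (-t))) * u t| / (2 * (A + 1)))
    (by positivity)
  rw [div_mul_eq_mul_div, le_div_iff₀ (by positivity)] at h1
  nlinarith

/-- Right-continuous functions on `[0, ∞)` are determined by their Laplace transforms at the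
points `S, S + 1, S + 2, …`. -/
lemma eq_of_laplace_eq {f g : ℝ → ℝ} {S : ℝ}
    (hf : IntegrableOn (fun t => Real.exp (-S * t) * f t) (Set.Ioi 0))
    (hg : IntegrableOn (fun t => Real.exp (-S * t) * g t) (Set.Ioi 0))
    (hfg : ∀ s, S ≤ s → ∫ t in Set.Ioi (0 : ℝ), Real.exp (-s * t) * f t
      = ∫ t in Set.Ioi (0 : ℝ), Real.exp (-s * t) * g t)
    (hfc : ∀ t, 0 ≤ t → ContinuousWithinAt f (Set.Ici t) t)
    (hgc : ∀ t, 0 ≤ t → ContinuousWithinAt g (Set.Ici t) t) {t : ℝ} (ht : 0 ≤ t) :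
    f t = g t := by
  have hbdd (n : ℕ) (k : ℝ → ℝ) (hk : IntegrableOn k (Set.Ioi 0)) :
      IntegrableOn (fun t => Real.exp (-t) ^ n * k t) (Set.Ioi 0) := by
    refine Integrable.bdd_mul (c := 1) hk (by fun_prop) ?_
    filter_upwards [ae_restrict_mem measurableSet_Ioi] with t ht
    rw [Real.norm_of_nonneg (by positivity)]
    exact pow_le_one₀ (Real.exp_pos _).le (Real.exp_le_one_iff.2 (neg_nonpos.2 (le_of_lt ht)))
  have hshift (n : ℕ) (k : ℝ → ℝ) (t : ℝ) : Real.exp (-t) ^ n * (Real.exp (-S * t) * k t)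
      = Real.exp (-(S + n) * t) * k t := by
    rw [← mul_assoc, ← Real.exp_nat_mul, ← Real.exp_add]
    ring_nf
  have hae := ae_eq_zero_of_laplace_nat_eq_zero (hf.sub hg) fun n => by
    have h1 := hbdd n _ hf
    have h2 := hbdd n _ hg
    simp only [Pi.sub_apply, mul_sub]
    rw [integral_sub h1 h2, sub_eq_zero]
    simp only [hshift]
    exact hfg _ (by simp)
  have hfreq : ∃ᶠ x in 𝓝[>] t, f x = g x := by
    intro hne
    obtain ⟨b, hb, hsub⟩ := (mem_nhdsGT_iff_exists_Ioo_subset (a := t)).1 hne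
    have h0 : volume (Set.Ioo t b) = 0 := by
      refine measure_mono_null (fun x hx => ?_) hae
      simp only [Set.mem_compl_iff, Set.mem_ofPred_eq, Classical.not_imp, Pi.sub_apply, ← mul_sub]
      exact ⟨ht.trans_lt hx.1, mul_ne_zero (Real.exp_pos _).ne' (sub_ne_zero.2 (hsub hx))⟩
    rw [Real.volume_Ioo, ENNReal.ofReal_eq_zero] at h0
    exact absurd hb (by simpa using h0)
  exact tendsto_nhds_unique_of_frequently_eq
    ((hfc t ht).mono_left (nhdsWithin_mono _ Set.Ioi_subset_Ici_self))
    ((hgc t ht).mono_left (nhdsWithin_mono _ Set.Ioi_subset_Ici_self)) hfreq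

lemma integrable_exp_neg_of_nonneg {Ω : Type*} [MeasurableSpace Ω] {P : Measure Ω}
    [IsProbabilityMeasure P] {X : Ω → ℝ} (hX : AEMeasurable X P) (hX0 : 0 ≤ᵐ[P] X)
    {s : ℝ} (hs : 0 ≤ s) : Integrable (fun ω => Real.exp (-s * X ω)) P := by
  refine Integrable.of_bound (C := 1) (by fun_prop) ?_
  filter_upwards [hX0] with ω hω
  rw [Real.norm_of_nonneg (Real.exp_pos _).le, Real.exp_le_one_iff]
  exact mul_nonpos_of_nonpos_of_nonneg (by linarith) hω

/-- The Laplace transform of the tail of a nonnegative random variable, in terms of the Laplace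
transform of its law. -/
lemma integral_exp_mul_survival {Ω : Type*} [MeasurableSpace Ω] {P : Measure Ω}
    [IsProbabilityMeasure P] {X : Ω → ℝ} (hX : AEMeasurable X P) (hX0 : 0 ≤ᵐ[P] X)
    {s : ℝ} (hs : 0 < s) :
    ∫ t in Set.Ioi (0 : ℝ), Real.exp (-s * t) * P.real {ω | t < X ω}
      = (1 - ∫ ω, Real.exp (-s * X ω) ∂P) / s := by
  have hlc := lintegral_comp_eq_lintegral_meas_lt_mul (g := fun t => Real.exp (-s * t)) P hX0 hX
    (fun t _ => (by fun_prop : Continuous fun t => Real.exp (-s * t)).intervalIntegrable _ _)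
    (ae_of_all _ fun t => (Real.exp_pos _).le)
  have hprim (x : ℝ) : ∫ t in (0 : ℝ)..x, Real.exp (-s * t) = (1 - Real.exp (-s * x)) / s := by
    rw [intervalIntegral.integral_comp_mul_left _ (neg_ne_zero.2 hs.ne'), integral_exp]
    simp only [mul_zero, Real.exp_zero, smul_eq_mul]
    field_simp
    ring
  simp only [hprim] at hlc
  have hexp := integrable_exp_neg_of_nonneg hX hX0 hs.le
  have hanti : Antitone fun t : ℝ => P.real {ω | t < X ω} := fun a b hab =>
    measureReal_mono fun ω hω => lt_of_le_of_lt hab hω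
  rw [integral_eq_lintegral_of_nonneg_ae
    (ae_of_all _ fun t => mul_nonneg (Real.exp_pos _).le measureReal_nonneg)
    ((by fun_prop : Measurable fun t => Real.exp (-s * t)).mul
      hanti.measurable).aestronglyMeasurable]
  have e : ∀ t : ℝ, ENNReal.ofReal (Real.exp (-s * t) * P.real {ω | t < X ω})
      = P {ω | t < X ω} * ENNReal.ofReal (Real.exp (-s * t)) := fun t => by
    rw [mul_comm, ENNReal.ofReal_mul measureReal_nonneg, ofReal_measureReal]
  simp only [e]
  rw [← hlc, ← integral_eq_lintegral_of_nonneg_ae, integral_div, integral_sub (by simp) hexp]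
  · simp
  · filter_upwards [hX0] with ω hω
    have : Real.exp (-s * X ω) ≤ 1 :=
      Real.exp_le_one_iff.2 (mul_nonpos_of_nonpos_of_nonneg (by linarith) hω)
    exact div_nonneg (by linarith) hs.le
  · exact (((integrable_const (1 : ℝ)).sub hexp).div_const s).aestronglyMeasurable

/-! ### The Mittag-Leffler function -/

lemma pow_mul_exp_neg_le_Gamma {R a : ℝ} (hR : 0 < R) (ha : 0 ≤ a) :
    R ^ a * Real.exp (-R) ≤ Real.Gamma (1 + a) := by
  have hint := Real.GammaIntegral_convergent (show 0 < 1 + a by linarith)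
  rw [Real.Gamma_eq_integral (by linarith), ← integral_exp_neg_Ioi, ← integral_const_mul]
  calc ∫ x in Set.Ioi R, R ^ a * Real.exp (-x)
      ≤ ∫ x in Set.Ioi R, Real.exp (-x) * x ^ (1 + a - 1) := by
        refine setIntegral_mono_on ?_ (hint.mono_set (Set.Ioi_subset_Ioi hR.le))
          measurableSet_Ioi fun x hx => ?_
        · simpa [IntegrableOn] using (exp_neg_integrableOn_Ioi R one_pos).const_mul (R ^ a)
        · rw [mul_comm, add_sub_cancel_left]
          gcongr
          exact le_of_lt hx
    _ ≤ _ := by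
        refine setIntegral_mono_set hint ?_ (Set.Ioi_subset_Ioi hR.le).eventuallyLE
        filter_upwards [ae_restrict_mem measurableSet_Ioi] with x hx
        exact mul_nonneg (Real.exp_pos _).le (Real.rpow_nonneg (le_of_lt hx) _)

lemma summable_pow_div_Gamma {β : ℝ} (hβ : 0 < β) {x : ℝ} (hx : 0 ≤ x) :
    Summable fun k : ℕ => x ^ k / Real.Gamma (1 + β * k) := by
  -- with `R ^ β = x + 1`, the terms are dominated by a geometric series of ratio `x / (x + 1)`
  set R := (x + 1) ^ β⁻¹
  have hR : 0 < R := by positivity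
  have hRβ : R ^ β = x + 1 := Real.rpow_inv_rpow (by positivity) hβ.ne'
  refine Summable.of_nonneg_of_le (fun k => ?_) (fun k => ?_)
    ((summable_geometric_of_lt_one (r := x / (x + 1)) (by positivity)
      ((div_lt_one (by positivity)).2 (by linarith))).mul_left (Real.exp R))
  · have : 0 < Real.Gamma (1 + β * k) := Real.Gamma_pos_of_pos (by positivity)
    positivity
  · have h := pow_mul_exp_neg_le_Gamma hR (show 0 ≤ β * k by positivity)
    rw [Real.rpow_mul hR.le, hRβ, Real.rpow_natCast] at h
    have hpos : 0 < (x + 1) ^ k * Real.exp (-R) := by positivity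
    refine (div_le_div_of_nonneg_left (by positivity) hpos h).trans_eq ?_
    rw [div_pow, Real.exp_neg]
    field_simp

lemma continuous_mittagLeffler {β : ℝ} (hβ : 0 < β) : Continuous (FracPoisson.mittagLeffler β) := by
  rw [continuous_iff_continuousAt]
  intro z
  refine ContinuousOn.continuousAt (s := Metric.closedBall 0 (|z| + 1)) ?_
    (Filter.mem_of_superset (Metric.isOpen_ball.mem_nhds (by simp)) Metric.ball_subset_closedBall)
  refine continuousOn_tsum (fun k => by fun_prop)
    (summable_pow_div_Gamma hβ (x := |z| + 1) (by positivity)) fun k x hx => ?_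
  have hG : 0 < Real.Gamma (1 + β * k) := Real.Gamma_pos_of_pos (by positivity)
  rw [mem_closedBall_zero_iff] at hx
  rw [norm_div, norm_pow, Real.norm_of_nonneg hG.le]
  gcongr

/-- The Laplace transform of `t ↦ E_β(c t^β)`, computed term by term. -/
lemma integral_exp_mul_mittagLeffler {β c s : ℝ} (hβ : 0 < β) (hs : 0 < s) (hc : |c| < s ^ β) :
    ∫ t in Set.Ioi (0 : ℝ), Real.exp (-s * t) * FracPoisson.mittagLeffler β (c * t ^ β)
      = s⁻¹ * (1 - c / s ^ β)⁻¹ := by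
  have hsβ : 0 < s ^ β := Real.rpow_pos_of_pos hs _
  set F : ℕ → ℝ → ℝ := fun k t =>
    (c ^ k / Real.Gamma (1 + β * k)) * (t ^ (1 + β * k - 1) * Real.exp (-(s * t)))
  have hG (k : ℕ) : 0 < Real.Gamma (1 + β * k) := Real.Gamma_pos_of_pos (by positivity)
  have hmom (k : ℕ) : ∫ t in Set.Ioi (0 : ℝ), t ^ (1 + β * k - 1) * Real.exp (-(s * t))
      = s⁻¹ * ((s ^ β)⁻¹) ^ k * Real.Gamma (1 + β * k) := by
    rw [Real.integral_rpow_mul_exp_neg_mul_Ioi (by positivity) hs, one_div,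
      Real.rpow_add (by positivity), Real.rpow_one, Real.rpow_mul (by positivity),
      Real.rpow_natCast, Real.inv_rpow hs.le]
  have hFi (k : ℕ) : IntegrableOn (F k) (Set.Ioi 0) := by
    have := integrableOn_rpow_mul_exp_neg_mul_rpow (p := 1) (s := 1 + β * k - 1) (b := s)
      (by have : 0 ≤ β * k := by positivity
          linarith) one_pos hs
    simp only [Real.rpow_one, neg_mul] at this
    exact this.const_mul _
  have hnorm (k : ℕ) : ∫ t in Set.Ioi (0 : ℝ), ‖F k t‖ = s⁻¹ * (|c| / s ^ β) ^ k := by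
    have : ∀ t ∈ Set.Ioi (0 : ℝ), ‖F k t‖ = (|c| ^ k / Real.Gamma (1 + β * k)) *
        (t ^ (1 + β * k - 1) * Real.exp (-(s * t))) := fun t ht => by
      have : 0 ≤ t ^ (1 + β * k - 1) := Real.rpow_nonneg (le_of_lt ht) _
      simp only [F]
      rw [norm_mul, norm_div, norm_pow, Real.norm_of_nonneg (hG k).le, Real.norm_eq_abs,
        Real.norm_of_nonneg (by positivity)]
    rw [setIntegral_congr_fun measurableSet_Ioi this, integral_const_mul, hmom]
    have := (hG k).ne'
    rw [div_eq_mul_inv _ (s ^ β), mul_pow]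
    field_simp
  have hval (k : ℕ) : ∫ t in Set.Ioi (0 : ℝ), F k t = s⁻¹ * (c / s ^ β) ^ k := by
    simp only [F]
    rw [integral_const_mul, hmom]
    have := (hG k).ne'
    rw [div_eq_mul_inv _ (s ^ β), mul_pow]
    field_simp
  have hsum := hasSum_integral_of_summable_integral_norm hFi (by
    simp only [hnorm]
    exact (summable_geometric_of_lt_one (by positivity) ((div_lt_one hsβ).2 hc)).mul_left _)
  simp only [hval] at hsum
  have hgeo := (hasSum_geometric_of_abs_lt_one (r := c / s ^ β) (by
    rwa [abs_div, abs_of_pos hsβ, div_lt_one hsβ])).mul_left s⁻¹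
  rw [← hsum.unique hgeo]
  refine setIntegral_congr_fun measurableSet_Ioi fun t ht => ?_
  simp only [FracPoisson.mittagLeffler, F]
  rw [← tsum_mul_left]
  refine tsum_congr fun k => ?_
  rw [add_sub_cancel_left, Real.rpow_mul (le_of_lt ht), Real.rpow_natCast, mul_pow, neg_mul]
  ring

/-- A nonnegative random variable with Laplace transform `lam / (lam + s^β)` has the
Mittag-Leffler distribution. -/
lemma survival_eq_mittagLeffler {Ω : Type*} [MeasurableSpace Ω] {P : Measure Ω}
    [IsProbabilityMeasure P] {X : Ω → ℝ} (hX : AEMeasurable X P) (hX0 : 0 ≤ᵐ[P] X)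
    {β lam : ℝ} (hβ : 0 < β) (hlam : 0 < lam)
    (hL : ∀ s, 0 < s → ∫ ω, Real.exp (-s * X ω) ∂P = lam / (lam + s ^ β))
    {t : ℝ} (ht : 0 ≤ t) :
    P.real {ω | t < X ω} = FracPoisson.mittagLeffler β (-lam * t ^ β) := by
  -- both Laplace transforms are known at every `s ≥ S`, where `S ^ β = lam + 1 > |-lam|`
  set S := (lam + 1) ^ β⁻¹
  have hS : 0 < S := by positivity
  have hSβ : S ^ β = lam + 1 := Real.rpow_inv_rpow (by positivity) hβ.ne'
  have hsβ {s : ℝ} (hs : S ≤ s) : |-lam| < s ^ β := by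
    have := Real.rpow_le_rpow hS.le hs hβ.le
    rw [abs_neg, abs_of_pos hlam]
    linarith
  have hf {s : ℝ} (hs : S ≤ s) := integral_exp_mul_survival hX hX0 (hS.trans_le hs)
  have hg {s : ℝ} (hs : S ≤ s) := integral_exp_mul_mittagLeffler hβ (hS.trans_le hs) (hsβ hs)
  have hnz {s : ℝ} (hs : S ≤ s) : s⁻¹ * (1 - -lam / s ^ β)⁻¹ ≠ 0 := by
    have h1 := hS.trans_le hs
    have : 0 < s ^ β := Real.rpow_pos_of_pos h1 _
    rw [neg_div, sub_neg_eq_add]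
    positivity
  have heq : ∀ s, S ≤ s → ∫ t in Set.Ioi (0 : ℝ), Real.exp (-s * t) * P.real {ω | t < X ω}
      = ∫ t in Set.Ioi (0 : ℝ), Real.exp (-s * t) *
        FracPoisson.mittagLeffler β (-lam * t ^ β) := fun s hs => by
    have h1 := hS.trans_le hs
    have : 0 < s ^ β := Real.rpow_pos_of_pos h1 _
    rw [hf hs, hg hs, hL s h1, neg_div, sub_neg_eq_add]
    field_simp
    ring
  -- an integral with a nonzero value is not the default value of a nonintegrable function
  have hfi := not_imp_comm.1 integral_undef
    ((heq S le_rfl).trans_ne ((hg le_rfl).trans_ne (hnz le_rfl)))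
  have hgi := not_imp_comm.1 integral_undef ((hg le_rfl).trans_ne (hnz le_rfl))
  refine eq_of_laplace_eq hfi hgi heq (fun x _ => ?_) (fun x _ => ?_) ht
  · have := Measure.isProbabilityMeasure_map hX
    have hcdf (y : ℝ) : P.real {ω | y < X ω} = 1 - cdf (P.map X) y := by
      rw [cdf_eq_real, map_measureReal_apply_of_aemeasurable hX measurableSet_Iic,
        ← probReal_compl_eq_one_sub₀ (hX.nullMeasurableSet_preimage measurableSet_Iic)]
      congr 1
      ext ω
      simp
    simp only [hcdf]
    exact continuousWithinAt_const.sub ((cdf (P.map X)).right_continuous x)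
  · refine ((continuous_mittagLeffler hβ).comp ?_).continuousWithinAt
    exact continuous_const.mul (Real.continuous_rpow_const hβ.le)

/-! ### Left limits along a countable dense set -/

open TopologicalSpace in
/-- The left limit `f(t-)` of a nondecreasing nonnegative path `f` on `[0, ∞)`, with `f(0-) = 0`,
as a function of `t` and of the values `d n = f (denseSeq ℝ≥0 n)` of the path on a countable dense
set. In this form it is jointly measurable in the time and the path. -/
noncomputable def leftValue (t : ℝ≥0) (d : ℕ → ℝ) : ℝ :=
  (⨆ n, if denseSeq ℝ≥0 n < t then ENNReal.ofReal (d n) else 0).toReal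

/-- The restriction of a path on `[0, ∞)` to a countable dense set. -/
noncomputable def denseRestrict (f : ℝ≥0 → ℝ) (n : ℕ) : ℝ :=
  f (TopologicalSpace.denseSeq ℝ≥0 n)

lemma exists_denseSeq_between {a b : ℝ≥0} (hab : a < b) :
    ∃ n, a < TopologicalSpace.denseSeq ℝ≥0 n ∧ TopologicalSpace.denseSeq ℝ≥0 n < b := by
  obtain ⟨_, ⟨n, rfl⟩, h⟩ := (TopologicalSpace.denseRange_denseSeq ℝ≥0).exists_between hab
  exact ⟨n, h⟩

lemma measurable_leftValue : Measurable fun p : ℝ≥0 × (ℕ → ℝ) => leftValue p.1 p.2 := by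
  refine (Measurable.iSup fun n => Measurable.ite ?_ ?_ measurable_const).ennreal_toReal
  · exact measurableSet_lt measurable_const measurable_fst
  · fun_prop

lemma leftValue_nonneg (t : ℝ≥0) (d : ℕ → ℝ) : 0 ≤ leftValue t d := ENNReal.toReal_nonneg

lemma leftValue_zero (d : ℕ → ℝ) : leftValue 0 d = 0 := by simp [leftValue]

lemma leftValue_le_iff {f : ℝ≥0 → ℝ} (hf : Monotone f) {t : ℝ≥0} {x : ℝ} (hx : 0 ≤ x) :
    leftValue t (denseRestrict f) ≤ x ↔ ∀ r < t, f r ≤ x := by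
  have hfin : (⨆ n, if TopologicalSpace.denseSeq ℝ≥0 n < t then
      ENNReal.ofReal (denseRestrict f n) else 0) ≠ ∞ := by
    refine ne_top_of_le_ne_top (b := ENNReal.ofReal (f t)) ENNReal.ofReal_ne_top
      (iSup_le fun n => ?_)
    split_ifs with h
    · exact ENNReal.ofReal_le_ofReal (hf h.le)
    · exact zero_le
  rw [leftValue, ← ENNReal.le_ofReal_iff_toReal_le hfin hx, iSup_le_iff]
  constructor
  · intro h r hr
    obtain ⟨n, h1, h2⟩ := exists_denseSeq_between hr
    have h3 := h n
    rw [if_pos h2, ENNReal.ofReal_le_ofReal_iff hx] at h3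
    exact (hf h1.le).trans h3
  · intro h n
    split_ifs with hn
    · exact ENNReal.ofReal_le_ofReal (h _ hn)
    · exact zero_le

lemma leftValue_mono {f : ℝ≥0 → ℝ} (hf : Monotone f) :
    Monotone fun t => leftValue t (denseRestrict f) := fun _ _ hst =>
  (leftValue_le_iff hf (leftValue_nonneg _ _)).2 fun r hr =>
    (leftValue_le_iff hf (leftValue_nonneg _ _)).1 le_rfl r (hr.trans_le hst)

/-- Left limits and first passage times: `T ≤ inf {r > 0 : f(r) > t}` if and only
if `f(T-) ≤ t`. Unboundedness of `f` rules out the default value `sInf ∅ = 0`. -/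
lemma le_sInf_iff_leftValue_le {f : ℝ≥0 → ℝ} (hf : Monotone f) (hf0 : f 0 = 0)
    (hfu : ∀ x, ∃ r, x < f r) {T t : ℝ≥0} :
    T ≤ sInf {r : ℝ≥0 | 0 < r ∧ (t : ℝ) < f r} ↔ leftValue T (denseRestrict f) ≤ t := by
  have hpos {r : ℝ≥0} (hr : (t : ℝ) < f r) : 0 < r := by
    rw [pos_iff_ne_zero]
    rintro rfl
    exact absurd hr (by simp [hf0])
  have hne : {r : ℝ≥0 | 0 < r ∧ (t : ℝ) < f r}.Nonempty := by
    obtain ⟨r, hr⟩ := hfu t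
    exact ⟨r, hpos hr, hr⟩
  rw [le_csInf_iff (OrderBot.bddBelow _) hne, leftValue_le_iff hf t.coe_nonneg]
  constructor
  · intro h r hr
    by_contra! hlt
    exact absurd (h r ⟨hpos hlt, hlt⟩) (not_le.2 hr)
  · rintro h r ⟨_, hr⟩
    by_contra! hlt
    exact absurd (h r hlt) (not_le.2 hr)

/-! ### Paths of renewal processes -/

/-- The renewal epoch `T_n = w 0 + ⋯ + w (n - 1)`, for nonnegative waiting times `w`. -/
noncomputable def epoch (w : ℕ → ℝ) (n : ℕ) : ℝ≥0 := ∑ i ∈ Finset.range n, (w i).toNNReal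

lemma epoch_succ (w : ℕ → ℝ) (n : ℕ) : epoch w (n + 1) = epoch w n + (w n).toNNReal :=
  Finset.sum_range_succ _ _

lemma monotone_epoch (w : ℕ → ℝ) : Monotone (epoch w) :=
  monotone_nat_of_le_succ fun n => by simp [epoch_succ]

lemma measurable_epoch (n : ℕ) : Measurable fun w => epoch w n := by
  unfold epoch
  fun_prop

lemma coe_epoch {w : ℕ → ℝ} (hw : ∀ i, 0 ≤ w i) (n : ℕ) :
    (epoch w n : ℝ) = ∑ i ∈ Finset.range n, w i := by
  simp [epoch, NNReal.coe_sum, Real.coe_toNNReal _ (hw _)]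

lemma le_count_iff {w : ℕ → ℝ} (hw : ∀ i, 0 ≤ w i) {N : ℝ≥0 → ℕ}
    (hN : ∀ t : ℝ≥0, IsGreatest {n : ℕ | ∑ i ∈ Finset.range n, w i ≤ (t : ℝ)} (N t))
    (n : ℕ) (t : ℝ≥0) : n ≤ N t ↔ epoch w n ≤ t := by
  have hmem (m : ℕ) : m ∈ {n : ℕ | ∑ i ∈ Finset.range n, w i ≤ (t : ℝ)} ↔ epoch w m ≤ t := by
    rw [Set.mem_ofPred_eq, ← coe_epoch hw, NNReal.coe_le_coe]
  exact ⟨fun h => (monotone_epoch w h).trans ((hmem _).1 (hN t).1), fun h =>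
    (hN t).2 ((hmem n).2 h)⟩

/-- The waiting times of a renewal process are measurable functions of its path. -/
lemma exists_measurable_waitingTimes : ∃ Θ : (ℝ≥0 → ℕ) → ℕ → ℝ, Measurable Θ ∧
    ∀ (w : ℕ → ℝ) (N : ℝ≥0 → ℕ), (∀ i, 0 ≤ w i) →
      (∀ t : ℝ≥0, IsGreatest {n : ℕ | ∑ i ∈ Finset.range n, w i ≤ (t : ℝ)} (N t)) → Θ N = w := by
  -- the `n`-th epoch is the supremum of the times `t` of a countable dense set with `N t < n`
  set τ : (ℝ≥0 → ℕ) → ℕ → ℝ≥0∞ := fun N n =>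
    ⨆ k, if N (TopologicalSpace.denseSeq ℝ≥0 k) < n then
      (TopologicalSpace.denseSeq ℝ≥0 k : ℝ≥0∞) else 0
  have hτm (n : ℕ) : Measurable fun N => τ N n := by
    refine Measurable.iSup fun k => Measurable.ite ?_ measurable_const measurable_const
    exact measurableSet_lt (measurable_pi_apply _) measurable_const
  refine ⟨fun N n => (τ N (n + 1)).toReal - (τ N n).toReal, measurable_pi_lambda _ fun n =>
    (hτm _).ennreal_toReal.sub (hτm _).ennreal_toReal, fun w N hw hN => ?_⟩
  have hτ (n : ℕ) : τ N n = epoch w n := by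
    have hlt (t : ℝ≥0) : N t < n ↔ t < epoch w n := by
      rw [← not_le, le_count_iff hw hN, not_le]
    refine le_antisymm (iSup_le fun k => ?_) (le_of_forall_lt fun a ha => ?_)
    · split_ifs with h
      · exact_mod_cast ((hlt _).1 h).le
      · exact zero_le
    · lift a to ℝ≥0 using ha.ne_top
      obtain ⟨k, h1, h2⟩ := exists_denseSeq_between (ENNReal.coe_lt_coe.1 ha)
      refine lt_of_lt_of_le (ENNReal.coe_lt_coe.2 h1) ((le_of_eq ?_).trans (le_iSup _ k))
      rw [if_pos ((hlt _).2 h2)]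
  funext n
  simp only [hτ, epoch_succ, ENNReal.coe_toReal, NNReal.coe_add, Real.coe_toNNReal _ (hw n),
    add_sub_cancel_left]

/-- The `n`-th jump of `N(E(t))` happens at the left limit of the subordinator path `f` at the
`n`-th epoch of `N`. -/
lemma le_timeChange_iff {w : ℕ → ℝ} (hw : ∀ i, 0 ≤ w i) {N : ℝ≥0 → ℕ}
    (hN : ∀ t : ℝ≥0, IsGreatest {n : ℕ | ∑ i ∈ Finset.range n, w i ≤ (t : ℝ)} (N t))
    {f : ℝ≥0 → ℝ} (hf : Monotone f) (hf0 : f 0 = 0) (hfu : ∀ x, ∃ r, x < f r)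
    (n : ℕ) (t : ℝ≥0) :
    n ≤ N (sInf {r : ℝ≥0 | 0 < r ∧ (t : ℝ) < f r}) ↔
      leftValue (epoch w n) (denseRestrict f) ≤ t := by
  rw [le_count_iff hw hN, le_sInf_iff_leftValue_le hf hf0 hfu]

/-- The time elapsed between the `n`-th and the `(n + 1)`-st jump of `N(E(t))`, as a function of the
waiting times `w` of `N` and of the subordinator on a dense set. -/
noncomputable def changedWaitingTime (w d : ℕ → ℝ) (n : ℕ) : ℝ :=
  leftValue (epoch w (n + 1)) d - leftValue (epoch w n) d

lemma sum_changedWaitingTime (w d : ℕ → ℝ) (n : ℕ) :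
    ∑ i ∈ Finset.range n, changedWaitingTime w d i = leftValue (epoch w n) d := by
  unfold changedWaitingTime
  rw [Finset.sum_range_sub fun i => leftValue (epoch w i) d]
  simp [epoch, leftValue_zero]

lemma measurable_changedWaitingTime :
    Measurable fun p : (ℕ → ℝ) × (ℕ → ℝ) => changedWaitingTime p.1 p.2 := by
  have h (n : ℕ) :
      Measurable fun p : (ℕ → ℝ) × (ℕ → ℝ) => leftValue (epoch p.1 n) p.2 := by
    have h1 : Measurable fun p : (ℕ → ℝ) × (ℕ → ℝ) => (epoch p.1 n, p.2) :=
      ((measurable_epoch n).comp measurable_fst).prodMk measurable_snd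
    have h2 := measurable_leftValue.comp h1
    simpa only [Function.comp_def] using h2
  exact measurable_pi_lambda _ fun n => (h (n + 1)).sub (h n)

section JumpTimes

variable {Ω : Type*} {M : ℝ≥0 → Ω → ℕ} {ω : Ω} {Z : ℕ → ℝ}

lemma timesBefore_eq (hM : ∀ n t, n ≤ M t ω ↔ Z n ≤ (t : ℝ)) (n : ℕ) :
    FracPoisson.timesBefore M n ω = {t : ℝ≥0 | 0 < t ∧ (t : ℝ) < Z n} := by
  ext t
  simp only [FracPoisson.timesBefore, Set.mem_ofPred_eq, ← not_le, hM]

lemma bddAbove_timesBefore (hM : ∀ n t, n ≤ M t ω ↔ Z n ≤ (t : ℝ)) (n : ℕ) :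
    BddAbove (FracPoisson.timesBefore M n ω) := by
  rw [timesBefore_eq hM]
  refine ⟨(Z n).toNNReal, fun t ht => ?_⟩
  exact NNReal.le_toNNReal_of_coe_le ht.2.le

lemma coe_jumpTime (hM : ∀ n t, n ≤ M t ω ↔ Z n ≤ (t : ℝ)) (hZ : ∀ n, 0 ≤ Z n) (n : ℕ) :
    (FracPoisson.jumpTime M n ω : ℝ) = Z n := by
  have hz := hZ n
  rw [FracPoisson.jumpTime, timesBefore_eq hM]
  lift Z n to ℝ≥0 using hz with z
  simp only [NNReal.coe_lt_coe, NNReal.coe_inj]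
  rcases eq_or_ne z 0 with rfl | h0
  · convert! csSup_empty
    ext t
    simp
  · exact csSup_Ioo (pos_iff_ne_zero.2 h0)

end JumpTimes

/-! ### Stable subordinators -/

section Subordinator

variable {Ω : Type*} [MeasurableSpace Ω] {P : Measure Ω} {β : ℝ}
  {D : ℝ≥0 → Ω → ℝ}

lemma ae_nonneg_subordinator (hD : FracPoisson.IsStableSubordinator β D P) :
    ∀ᵐ ω ∂P, ∀ t, 0 ≤ D t ω := by
  filter_upwards [hD.zero, hD.mono] with ω h0 hm t
  exact h0 ▸ hm (zero_le : (0 : ℝ≥0) ≤ t)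

/-- Almost every path of a stable subordinator is unbounded, since `E[exp (-D(r))] = exp (-r)`
tends to `0`. -/
lemma ae_unbounded_subordinator [IsProbabilityMeasure P]
    (hD : FracPoisson.IsStableSubordinator β D P) :
    ∀ᵐ ω ∂P, ∀ x, ∃ r, x < D r ω := by
  have hnat : ∀ᵐ ω ∂P, ∀ m : ℕ, ∃ r, (m : ℝ) < D r ω := by
    rw [ae_all_iff]
    intro m
    rw [ae_iff]
    have hle : ∀ r : ℕ, P {ω | ¬ ∃ r, (m : ℝ) < D r ω} ≤
        ENNReal.ofReal (Real.exp m * Real.exp (-(r : ℝ))) := by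
      intro r
      have hsub : {ω | ¬ ∃ r, (m : ℝ) < D r ω} ⊆
          {ω | Real.exp (-(m : ℝ)) ≤ Real.exp (-1 * D (r : ℝ≥0) ω)} := by
        intro ω hω
        simp only [not_exists, not_lt, Set.mem_ofPred_eq] at hω ⊢
        rw [Real.exp_le_exp]
        linarith [hω (r : ℝ≥0)]
      have hmark := mul_meas_ge_le_integral_of_nonneg
        (ae_of_all P fun ω => (Real.exp_pos (-1 * D (r : ℝ≥0) ω)).le)
        (integrable_exp_neg_of_nonneg (hD.measurable r).aemeasurable
          ((ae_nonneg_subordinator hD).mono fun ω h => h _) zero_le_one)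
        (Real.exp (-(m : ℝ)))
      rw [hD.laplace _ _ one_pos] at hmark
      refine (measure_mono hsub).trans ?_
      rw [← ofReal_measureReal]
      refine ENNReal.ofReal_le_ofReal ?_
      have he : Real.exp m * Real.exp (-(m : ℝ)) = 1 := by rw [← Real.exp_add]; simp
      have h2 := mul_le_mul_of_nonneg_left hmark (Real.exp_pos (m : ℝ)).le
      rw [← mul_assoc, he, one_mul] at h2
      simpa using h2
    have ht : Tendsto (fun r : ℕ => Real.exp m * Real.exp (-(r : ℝ))) atTop (𝓝 (Real.exp m * 0)) :=
      (Real.tendsto_exp_neg_atTop_nhds_zero.comp tendsto_natCast_atTop_atTop).const_mul _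
    have ht0 := ENNReal.tendsto_ofReal ht
    rw [mul_zero, ENNReal.ofReal_zero] at ht0
    exact le_antisymm (ge_of_tendsto' ht0 hle) zero_le
  filter_upwards [hnat] with ω h x
  obtain ⟨m, hm⟩ := exists_nat_ge x
  obtain ⟨r, hr⟩ := h m
  exact ⟨r, hm.trans_lt hr⟩

lemma measurable_denseRestrict (hD : FracPoisson.IsStableSubordinator β D P) :
    Measurable fun ω => denseRestrict fun t => D t ω :=
  measurable_pi_lambda _ fun _ => hD.measurable _

/-- A stable subordinator has no fixed discontinuities: `D(t-) ≤ D(t)`, and both sides have the same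
Laplace transform at `1`. -/
lemma ae_leftValue_eq [IsProbabilityMeasure P]
    (hD : FracPoisson.IsStableSubordinator β D P) (t : ℝ≥0) :
    ∀ᵐ ω ∂P, leftValue t (denseRestrict fun r => D r ω) = D t ω := by
  set L : Ω → ℝ := fun ω => leftValue t (denseRestrict fun r => D r ω)
  have hLm : Measurable L :=
    measurable_leftValue.comp (measurable_const.prodMk (measurable_denseRestrict hD))
  have hL0 : 0 ≤ᵐ[P] L := ae_of_all _ fun ω => leftValue_nonneg _ _
  have hnn := ae_nonneg_subordinator hD
  have hi (r : ℝ≥0) : Integrable (fun ω => Real.exp (-1 * D r ω)) P :=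
    integrable_exp_neg_of_nonneg (hD.measurable r).aemeasurable (hnn.mono fun ω h => h _)
      zero_le_one
  have hiL : Integrable (fun ω => Real.exp (-1 * L ω)) P :=
    integrable_exp_neg_of_nonneg hLm.aemeasurable hL0 zero_le_one
  have hLD : ∀ᵐ ω ∂P, L ω ≤ D t ω := by
    filter_upwards [hD.mono, hnn] with ω hm h0
    exact (leftValue_le_iff hm (h0 t)).2 fun r hr => hm hr.le
  have hlap (r : ℝ≥0) : ∫ ω, Real.exp (-1 * D r ω) ∂P = Real.exp (-(r : ℝ)) := by
    rw [hD.laplace r 1 one_pos, Real.one_rpow, mul_one]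
  have hlt (r : ℝ≥0) (hr : r < t) : ∫ ω, Real.exp (-1 * L ω) ∂P ≤ Real.exp (-(r : ℝ)) := by
    rw [← hlap]
    refine integral_mono_ae hiL (hi r) ?_
    filter_upwards [hD.mono] with ω hm
    have : D r ω ≤ L ω := (leftValue_le_iff hm (leftValue_nonneg _ _)).1 le_rfl r hr
    simpa using this
  have hle : ∫ ω, Real.exp (-1 * L ω) ∂P ≤ Real.exp (-(t : ℝ)) := by
    rcases eq_or_ne t 0 with rfl | ht
    · simp [L, leftValue_zero]
    · have hc : Tendsto (fun r : ℝ≥0 => Real.exp (-(r : ℝ))) (𝓝[<] t) (𝓝 (Real.exp (-(t : ℝ)))) :=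
        ((by fun_prop : Continuous fun r : ℝ≥0 => Real.exp (-(r : ℝ))).tendsto t).mono_left
          nhdsWithin_le_nhds
      have : (𝓝[<] t).NeBot := nhdsLT_neBot_of_exists_lt ⟨0, pos_iff_ne_zero.2 ht⟩
      exact ge_of_tendsto hc (eventually_nhdsWithin_of_forall hlt)
  have hdiff : 0 ≤ᵐ[P] fun ω => Real.exp (-1 * L ω) - Real.exp (-1 * D t ω) := by
    filter_upwards [hLD] with ω h
    simpa using h
  have hzero := (integral_eq_zero_iff_of_nonneg_ae hdiff (hiL.sub (hi t))).1 (by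
    refine le_antisymm ?_ (integral_nonneg_of_ae hdiff)
    rw [integral_sub hiL (hi t), hlap]
    linarith)
  filter_upwards [hzero] with ω h
  simpa [sub_eq_zero] using h

end Subordinator

/-! ### The law of the waiting times -/

section Law

variable {Ω : Type*} [MeasurableSpace Ω] {P : Measure Ω} {β lam : ℝ}
  {D : ℝ≥0 → Ω → ℝ} {W : ℕ → Ω → ℝ}

lemma FracPoisson.IsIIDWaitingTimes.ae_nonneg [IsProbabilityMeasure P] {S : ℝ≥0 → ℝ}
    (hW : FracPoisson.IsIIDWaitingTimes W S P) (hS : S 0 = 1) : ∀ᵐ ω ∂P, ∀ i, 0 ≤ W i ω := by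
  rw [ae_all_iff]
  intro i
  have h1 : P.real {ω | (0 : ℝ) < W i ω} = 1 := by simpa [hS] using hW.survival i 0
  have h2 : P {ω | (0 : ℝ) < W i ω} = 1 := by
    rw [← ofReal_measureReal, h1, ENNReal.ofReal_one]
  have h3 := (prob_compl_eq_zero_iff₀
    ((hW.aemeasurable i).nullMeasurableSet_preimage measurableSet_Ioi)).2 h2
  filter_upwards [mem_ae_iff.2 h3] with ω hω using le_of_lt hω

lemma integral_exp_neg_mul_exponential [IsProbabilityMeasure P]
    (hlam : 0 < lam) {X : Ω → ℝ} (hX : AEMeasurable X P) (hX0 : 0 ≤ᵐ[P] X)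
    (hS : ∀ t : ℝ≥0, P.real {ω | (t : ℝ) < X ω} = Real.exp (-lam * t)) {a : ℝ} (ha : 0 < a) :
    ∫ ω, Real.exp (-a * X ω) ∂P = lam / (lam + a) := by
  have h := integral_exp_mul_survival hX hX0 ha
  have h2 : ∫ t in Set.Ioi (0 : ℝ), Real.exp (-a * t) * P.real {ω | t < X ω} = 1 / (lam + a) := by
    rw [setIntegral_congr_fun (g := fun t => Real.exp (-(lam + a) * t)) measurableSet_Ioi,
      integral_exp_mul_Ioi (by linarith)]
    · simp only [mul_zero, Real.exp_zero]
      rw [neg_div_neg_eq]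
    · intro t ht
      have := hS ⟨t, le_of_lt ht⟩
      change Real.exp (-a * t) * P.real {ω | t < X ω} = Real.exp (-(lam + a) * t)
      rw [show P.real {ω | t < X ω} = Real.exp (-lam * t) from this, ← Real.exp_add]
      ring_nf
  rw [h2] at h
  field_simp at h ⊢
  linarith

/-- Conditionally on the waiting times `W`, the time-changed waiting times have the law of the
increments of the subordinator between the epochs of `W`. -/
lemma lintegral_changedWaitingTime [IsProbabilityMeasure P]
    (hD : FracPoisson.IsStableSubordinator β D P) (hW : ∀ i, AEMeasurable (W i) P)
    (hWD : IndepFun (fun ω i => W i ω) (fun ω => denseRestrict fun t => D t ω) P)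
    {F : (ℕ → ℝ) → ℝ≥0∞} (hF : Measurable F) :
    ∫⁻ ω, F (changedWaitingTime (fun i => W i ω) (denseRestrict fun t => D t ω)) ∂P
      = ∫⁻ ω, ∫⁻ ω', F (fun n => D (epoch (fun i => W i ω) (n + 1)) ω'
          - D (epoch (fun i => W i ω) n) ω') ∂P ∂P := by
  have hWm : AEMeasurable (fun ω i => W i ω) P := aemeasurable_pi_lambda _ hW
  have hDm := measurable_denseRestrict hD
  have hG : Measurable fun p : (ℕ → ℝ) × (ℕ → ℝ) => F (changedWaitingTime p.1 p.2) := by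
    have h := hF.comp measurable_changedWaitingTime
    simpa only [Function.comp_def] using h
  rw [← lintegral_map' (μ := P) hG.aemeasurable (hWm.prodMk hDm.aemeasurable),
    hWD.map_prod_eq_prod_map_map hWm hDm.aemeasurable, lintegral_prod _ hG.aemeasurable,
    lintegral_map' hG.lintegral_prod_right'.aemeasurable hWm]
  refine lintegral_congr fun ω => ?_
  have hGω : Measurable fun d => F (changedWaitingTime (fun i => W i ω) d) := by
    have h := hG.comp (measurable_prodMk_left (x := fun i => W i ω))
    simpa only [Function.comp_def] using h
  rw [lintegral_map hGω hDm]
  refine lintegral_congr_ae ?_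
  filter_upwards [ae_all_iff.2 fun n => ae_leftValue_eq hD (epoch (fun i => W i ω) n)] with ω' h
  simp only [← h]
  rfl

/-- The increment over the `n`-th waiting time `w n` is distributed as `D (w n)`. -/
lemma identDistrib_increment_epoch (hD : FracPoisson.IsStableSubordinator β D P) (w : ℕ → ℝ)
    (n : ℕ) : IdentDistrib (fun ω => D (epoch w (n + 1)) ω - D (epoch w n) ω)
      (D (w n).toNNReal) P P := by
  rw [epoch_succ]
  exact hD.stationary _ _

lemma ae_changedWaitingTime_nonneg (hD : FracPoisson.IsStableSubordinator β D P) (n : ℕ) :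
    ∀ᵐ ω ∂P, 0 ≤ changedWaitingTime (fun i => W i ω) (denseRestrict fun t => D t ω) n := by
  filter_upwards [hD.mono] with ω hm
  exact sub_nonneg.2 (leftValue_mono hm (monotone_epoch _ n.le_succ))

lemma aemeasurable_changedWaitingTime (hD : FracPoisson.IsStableSubordinator β D P)
    (hW : ∀ i, AEMeasurable (W i) P) : AEMeasurable (fun ω =>
      changedWaitingTime (fun i => W i ω) (denseRestrict fun t => D t ω)) P := by
  have h := measurable_changedWaitingTime.comp_aemeasurable
    ((aemeasurable_pi_lambda _ hW).prodMk (measurable_denseRestrict hD).aemeasurable)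
  simpa only [Function.comp_def] using h

lemma iIndepFun_changedWaitingTime [IsProbabilityMeasure P]
    (hD : FracPoisson.IsStableSubordinator β D P)
    (hW : ∀ i, AEMeasurable (W i) P) (hWi : iIndepFun W P)
    (hWD : IndepFun (fun ω i => W i ω) (fun ω => denseRestrict fun t => D t ω) P) :
    iIndepFun (fun n ω =>
      changedWaitingTime (fun i => W i ω) (denseRestrict fun t => D t ω) n) P := by
  rw [iIndepFun_iff_measure_inter_preimage_eq_mul]
  intro S B hB
  -- `m i x` is the probability that an increment over a time `x` lies in `B i`
  set m : ℕ → ℝ → ℝ≥0∞ := fun i x => if i ∈ S then P {ω | D x.toNNReal ω ∈ B i} else 1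
  have hm (i : ℕ) : Measurable (m i) := by
    by_cases hi : i ∈ S
    · have hms : MeasurableSet {p : ℝ × (ℕ → ℝ) | leftValue p.1.toNNReal p.2 ∈ B i} := by
        have h1 : Measurable fun p : ℝ × (ℕ → ℝ) => (p.1.toNNReal, p.2) := by fun_prop
        exact (measurable_leftValue.comp h1) (hB i hi)
      have := measurable_measure_prodMk_left
        (ν := P.map fun ω => denseRestrict fun t => D t ω) hms
      convert! this using 2 with x
      simp only [m, if_pos hi]
      rw [Measure.map_apply (measurable_denseRestrict hD) (measurable_prodMk_left hms)]
      refine measure_congr ?_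
      filter_upwards [ae_leftValue_eq hD x.toNNReal] with ω h
      exact congrArg (· ∈ B i) h.symm
    · simp only [m, if_neg hi]
      exact measurable_const
  have hjoint (R : Finset ℕ) (hR : R ⊆ S) :
      P (⋂ i ∈ R, (fun ω => changedWaitingTime (fun i => W i ω)
        (denseRestrict fun t => D t ω) i) ⁻¹' B i) = ∏ i ∈ R, ∫⁻ ω, m i (W i ω) ∂P := by
    have hC : MeasurableSet {x : ℕ → ℝ | ∀ i ∈ R, x i ∈ B i} := by
      simp only [Set.ofPred_forall]
      exact R.measurableSet_biInter fun i hi => measurable_pi_apply i (hB i (hR hi))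
    have h := lintegral_changedWaitingTime hD hW hWD (measurable_one.indicator hC)
    have hJ := aemeasurable_changedWaitingTime hD hW
    rw [← lintegral_map' (μ := P) (measurable_one.indicator hC).aemeasurable hJ,
      lintegral_indicator_one hC, Measure.map_apply_of_aemeasurable hJ hC] at h
    have hset : (⋂ i ∈ R, (fun ω => changedWaitingTime (fun i => W i ω)
        (denseRestrict fun t => D t ω) i) ⁻¹' B i) = (fun ω => changedWaitingTime (fun i => W i ω)
        (denseRestrict fun t => D t ω)) ⁻¹' {x : ℕ → ℝ | ∀ i ∈ R, x i ∈ B i} := by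
      ext ω
      simp
    rw [hset, h]
    have hcond (ω : Ω) : ∫⁻ ω', {x : ℕ → ℝ | ∀ i ∈ R, x i ∈ B i}.indicator 1
        (fun n => D (epoch (fun i => W i ω) (n + 1)) ω' - D (epoch (fun i => W i ω) n) ω') ∂P
        = ∏ i ∈ R, m i (W i ω) := by
      have hinc : Measurable fun ω' n => D (epoch (fun i => W i ω) (n + 1)) ω'
          - D (epoch (fun i => W i ω) n) ω' :=
        measurable_pi_lambda _ fun n => (hD.measurable _).sub (hD.measurable _)
      rw [← lintegral_map (μ := P) (measurable_one.indicator hC) hinc, lintegral_indicator_one hC,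
        Measure.map_apply hinc hC]
      have hind := (hD.indep.nat (monotone_epoch fun i => W i ω)).measure_inter_preimage_eq_mul R
        (sets := B) fun i hi => hB i (hR hi)
      convert! hind using 1
      · congr 1
        ext ω'
        simp
      · refine Finset.prod_congr rfl fun i hi => ?_
        simp only [m, if_pos (hR hi)]
        exact ((identDistrib_increment_epoch hD (fun i => W i ω) i).measure_mem_eq
          (hB i (hR hi))).symm
    simp only [hcond]
    -- the product formula for expectations is stated for measurable functions
    have hWi' : iIndepFun (fun i => (hW i).mk) P := hWi.congr fun i => (hW i).ae_eq_mk
    have hprod := lintegral_prod_eq_prod_lintegral_of_indepFun R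
      (fun i ω => m i ((hW i).mk (W i) ω)) (hWi'.comp m hm)
      fun i => (hm i).comp (hW i).measurable_mk
    have hmk : ∀ᵐ ω ∂P, ∀ i, W i ω = (hW i).mk (W i) ω := ae_all_iff.2 fun i => (hW i).ae_eq_mk
    rw [lintegral_congr_ae (g := fun ω => ∏ i ∈ R, m i ((hW i).mk (W i) ω))
      (hmk.mono fun ω h => by simp only [h]), hprod]
    exact Finset.prod_congr rfl fun i _ => lintegral_congr_ae (hmk.mono fun ω h => by simp only [h])
  rw [hjoint S subset_rfl]
  refine Finset.prod_congr rfl fun i hi => ?_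
  have := hjoint {i} (by simpa using hi)
  simpa using this.symm

/-- `E[exp (-s J)] = E[exp (-s^β W)] = lam / (lam + s^β)`, for a time-changed waiting time `J` and
an exponential waiting time `W`. -/
lemma integral_exp_neg_mul_changedWaitingTime [IsProbabilityMeasure P] (hlam : 0 < lam)
    (hD : FracPoisson.IsStableSubordinator β D P)
    (hW : FracPoisson.IsIIDWaitingTimes W (fun t => Real.exp (-lam * t)) P)
    (hWD : IndepFun (fun ω i => W i ω) (fun ω => denseRestrict fun t => D t ω) P) (n : ℕ)
    {s : ℝ} (hs : 0 < s) :
    ∫ ω, Real.exp (-s * changedWaitingTime (fun i => W i ω) (denseRestrict fun t => D t ω) n) ∂P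
      = lam / (lam + s ^ β) := by
  have hF : Measurable fun x : ℕ → ℝ => ENNReal.ofReal (Real.exp (-s * x n)) := by fun_prop
  have hJ := aemeasurable_pi_iff.1 (aemeasurable_changedWaitingTime hD hW.aemeasurable) n
  have hnn := hW.ae_nonneg (by simp)
  have hcond (ω : Ω) : ∫⁻ ω', ENNReal.ofReal (Real.exp (-s *
      (D (epoch (fun i => W i ω) (n + 1)) ω' - D (epoch (fun i => W i ω) n) ω'))) ∂P
      = ENNReal.ofReal (Real.exp (-(s ^ β) * (W n ω).toNNReal)) := by
    have hid := (identDistrib_increment_epoch hD (fun i => W i ω) n).comp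
      (u := fun x => ENNReal.ofReal (Real.exp (-s * x))) (by fun_prop)
    refine hid.lintegral_eq.trans ?_
    simp only [Function.comp_apply]
    rw [← ofReal_integral_eq_lintegral_ofReal _ (ae_of_all _ fun _ => (Real.exp_pos _).le),
      hD.laplace _ _ hs]
    · ring_nf
    · exact integrable_exp_neg_of_nonneg (hD.measurable _).aemeasurable
        ((ae_nonneg_subordinator hD).mono fun ω h => h _) hs.le
  have key := lintegral_changedWaitingTime hD hW.aemeasurable hWD hF
  simp only [hcond] at key
  rw [integral_eq_lintegral_of_nonneg_ae (ae_of_all _ fun _ => (Real.exp_pos _).le)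
    (by exact (Real.measurable_exp.comp_aemeasurable (hJ.const_mul (-s))).aestronglyMeasurable),
    key, ← integral_eq_lintegral_of_nonneg_ae (ae_of_all _ fun _ => (Real.exp_pos _).le)]
  · rw [← integral_exp_neg_mul_exponential hlam (hW.aemeasurable n) (hnn.mono fun ω h => h n)
      (hW.survival n) (Real.rpow_pos_of_pos hs β)]
    refine integral_congr_ae (hnn.mono fun ω h => ?_)
    simp only [Real.coe_toNNReal _ (h n)]
  · have := hW.aemeasurable n
    fun_prop

lemma isIIDWaitingTimes_changedWaitingTime [IsProbabilityMeasure P] (hβ : 0 < β) (hlam : 0 < lam)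
    (hD : FracPoisson.IsStableSubordinator β D P)
    (hW : FracPoisson.IsIIDWaitingTimes W (fun t => Real.exp (-lam * t)) P)
    (hWD : IndepFun (fun ω i => W i ω) (fun ω => denseRestrict fun t => D t ω) P) :
    FracPoisson.IsIIDWaitingTimes (fun n ω =>
      changedWaitingTime (fun i => W i ω) (denseRestrict fun t => D t ω) n)
      (FracPoisson.mittagLefflerSurvival β lam) P := by
  have hJ := aemeasurable_pi_iff.1 (aemeasurable_changedWaitingTime hD hW.aemeasurable)
  exact ⟨hJ, iIndepFun_changedWaitingTime hD hW.aemeasurable hW.indep hWD, fun n t =>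
    survival_eq_mittagLeffler (hJ n) (ae_changedWaitingTime_nonneg hD n) hβ hlam
      (fun s hs => integral_exp_neg_mul_changedWaitingTime hlam hD hW hWD n hs) t.coe_nonneg⟩

lemma FracPoisson.IsIIDWaitingTimes.congr {J X : ℕ → Ω → ℝ} {S : ℝ≥0 → ℝ}
    (hJ : FracPoisson.IsIIDWaitingTimes J S P) (h : ∀ n, J n =ᵐ[P] X n) :
    FracPoisson.IsIIDWaitingTimes X S P := by
  refine ⟨fun n => (hJ.aemeasurable n).congr (h n), hJ.indep.congr h, fun n t => ?_⟩
  rw [← hJ.survival n t]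
  refine measureReal_congr ?_
  filter_upwards [h n] with ω hω
  exact congrArg ((t : ℝ) < ·) hω.symm

end Law

/-! ### The time-changed Poisson process -/

theorem theorem2p2 {Ω : Type*} [MeasurableSpace Ω] (P : Measure Ω) [IsProbabilityMeasure P]
    (β lam : ℝ) (hβ0 : 0 < β) (hβ1 : β < 1) (hlam : 0 < lam)
    (N : ℝ≥0 → Ω → ℕ) (hN : FracPoisson.IsPoissonProcess lam N P)
    (D : ℝ≥0 → Ω → ℝ) (hD : FracPoisson.IsStableSubordinator β D P)
    (hND : IndepFun (fun ω t => N t ω) (fun ω t => D t ω) P) :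
    FracPoisson.IsFractionalPoissonProcess β lam
        (FracPoisson.timeChange N (FracPoisson.inverse D)) P ∧
      (∀ᵐ ω ∂P, ∀ n,
        BddAbove (FracPoisson.timesBefore (FracPoisson.timeChange N (FracPoisson.inverse D)) n ω)) ∧
      FracPoisson.IsIIDWaitingTimes
        (FracPoisson.waitingTime (FracPoisson.timeChange N (FracPoisson.inverse D)))
        (FracPoisson.mittagLefflerSurvival β lam) P := by
  obtain ⟨W, hW⟩ := hN
  have hWnn : ∀ᵐ ω ∂P, ∀ i, 0 ≤ W i ω := hW.waiting.ae_nonneg (by simp)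
  -- the waiting times inherit from `N` the independence of `D`
  have hWD : IndepFun (fun ω i => W i ω) (fun ω => denseRestrict fun t => D t ω) P := by
    obtain ⟨Θ, hΘ, hrec⟩ := exists_measurable_waitingTimes
    have hres : Measurable denseRestrict := measurable_pi_lambda _ fun _ => measurable_pi_apply _
    refine (hND.comp hΘ hres).congr ?_ .rfl
    filter_upwards [hWnn, hW.count] with ω h1 h2
    exact hrec _ _ h1 h2
  set J : ℕ → Ω → ℝ := fun n ω =>
    changedWaitingTime (fun i => W i ω) (denseRestrict fun t => D t ω) n
  have hJ : FracPoisson.IsIIDWaitingTimes J (FracPoisson.mittagLefflerSurvival β lam) P :=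
    isIIDWaitingTimes_changedWaitingTime hβ0 hlam hD hW.waiting hWD
  have hjump : ∀ᵐ ω ∂P, ∀ (n : ℕ) (t : ℝ≥0),
      n ≤ FracPoisson.timeChange N (FracPoisson.inverse D) t ω ↔
        leftValue (epoch (fun i => W i ω) n) (denseRestrict fun t => D t ω) ≤ t := by
    filter_upwards [hWnn, hW.count, hD.mono, hD.zero, ae_unbounded_subordinator hD]
      with ω h1 h2 h3 h4 h5
    exact le_timeChange_iff h1 h2 h3 h4 h5
  refine ⟨⟨J, hJ, ?_⟩, ?_, hJ.congr fun n => ?_⟩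
  · filter_upwards [hjump] with ω h t
    simp only [J, sum_changedWaitingTime, ← h]
    exact isGreatest_Iic
  · filter_upwards [hjump] with ω h n using bddAbove_timesBefore h n
  · filter_upwards [hjump] with ω h
    simp only [FracPoisson.waitingTime, coe_jumpTime h fun _ => leftValue_nonneg _ _]
    rfl
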